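/- Consider $J\ge 1$ ex ante identical sellers and a unit mass of consumers, a fraction $\lambda\in[0,1]$ of whom shop on a platform. A seller produces quality $q$ at cost $q^2/2$. On-platform values $\theta_j$ are i.i.d. with distribution $F$ and density $f$, off-platform expected values are i.i.d. with distribution $G$ and density $g>0$, both on $[\theta_L,\theta_H]$ with $0\le\theta_L<\theta_H<\infty$, and $F$ is a mean-preserving spread of $G$. An (off-platform) menu is an incentive compatible and individually rational schedule of prices $\widehat p$ and qualities $\widehat q\ge 0$, with rent $\widehat U(\theta)=\theta\widehat q(\theta)-\widehat p(\theta)\ge 0$, so that $\widehat U'=\widehat q$ (at a kink of $\widehat U$ the type gets the lower quality: $\widehat q$ is the left derivative of $\widehat U$, the right derivative at $\theta_L$). Write $m(\theta)=\theta\widehat q(\theta)-\widehat q(\theta)^2/2-\widehat U(\theta)$. Without organic links, a seller's gross profit from a menu is $$(1-\lambda)\int m\,G^{J-1}g\,d\theta+\lambda\int\big(\theta^2/2-\widehat U\big)F^{J-1}f\,d\theta,$$ an equilibrium menu maximizes it, and the outside option is $\overline\Pi=\sup(1-\lambda)\int m\,G^{J-1}g\,d\theta$ over menus. With organic links, which display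 all off-platform menus to on-platform consumers, when all competitors use the menu with rent $\widehat U_k$ the gross profit is $$(1-\lambda)\int m\,G^{J-1}g\,d\theta+\lambda\int\big(\theta^2/2-\widehat U\big)\min\{F^{J-1}(\theta_k^*),F^{J-1}\}f\,d\theta+\lambda\int m\,\max\{0,F^{J-1}(\theta_k^*)-F^{J-1}\}f\,d\theta,$$ where $\theta_k^*=\theta_k^*(\theta)$ is the value with $\widehat U_k(\theta_k^*)=\widehat U(\theta)$; in general $F(\theta^*_k(\theta))$ stands for the probability that $\widehat U_k\le\widehat U(\theta)$ in the second term and that $\widehat U_k<\widehat U(\theta)$ elsewhere (ties are won by the advertised seller). A symmetric equilibrium menu is a best response to itself, and, given it, the outside option of a seller who does not participate in the campaign is $\widetilde\Pi=\sup\int m\,[(1-\lambda)G^{J-1}g+\lambda F^{J-1}(\theta_k^*)f]\,d\theta$ over menus. In both cases the advertising budget is the equilibrium gross profit minus the outside option. Then for every equilibrium menu without organic links and every symmetric equilibrium menu with organic links in which no off-platform product is priced below its cost: 1. $\widehat q(\theta)$ and $\widehat U(\theta)$ are weakly higher with organic links than without, for every $\theta\in[\theta_L,\theta_H]$. 2.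 The sellers' gross profit is weakly lower, their outside option (finite in both cases) is weakly higher, and hence the advertising budget is weakly lower, with organic links than without. -/

import Mathlib

open MeasureTheory

noncomputable section

/-- Primitives of the model. `J` ex ante identical sellers, a fraction `lam` of on-platform consumers.
On the platform a consumer's values for the sellers are i.i.d. with density `f` on `[lo, hi]`; off the
platform the expected values are i.i.d. with density `g` on `[lo, hi]`. The distribution of values is a
mean-preserving spread of the distribution of expected values. -/
structure Market where
  lo : ℝ
  hi : ℝ
  lam : ℝ
  J : ℕ
  f : ℝ → ℝ
  g : ℝ → ℝ
  lo_nonneg : 0 ≤ lo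
  lo_lt_hi : lo < hi
  lam_nonneg : 0 ≤ lam
  lam_le_one : lam ≤ 1
  one_le_J : 1 ≤ J
  f_integrable : IntervalIntegrable f volume lo hi
  g_integrable : IntervalIntegrable g volume lo hi
  f_nonneg : ∀ x ∈ Set.Ioo lo hi, 0 ≤ f x
  g_pos : ∀ x ∈ Set.Ioo lo hi, 0 < g x
  f_total : ∫ x in lo..hi, f x = 1
  g_total : ∫ x in lo..hi, g x = 1
  spread_le : ∀ v ∈ Set.Icc lo hi,
    ∫ t in v..hi, (∫ x in lo..t, f x) ≤ ∫ t in v..hi, (∫ x in lo..t, g x)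
  spread_eq : ∫ t in lo..hi, (∫ x in lo..t, f x) = ∫ t in lo..hi, (∫ x in lo..t, g x)

namespace Market

/-- Distribution function of an on-platform value, on `[lo, hi]`. -/
def F (m : Market) (t : ℝ) : ℝ := ∫ x in m.lo..t, m.f x

/-- Distribution function of an off-platform expected value, on `[lo, hi]`. -/
def G (m : Market) (t : ℝ) : ℝ := ∫ x in m.lo..t, m.g x

/-- An off-platform menu of (price, quality) pairs, one for each value in `[lo, hi]`, which is
incentive compatible and individually rational. A value at which two qualities are optimal
(a kink of the rent function) is assigned the lower one, so that the quality schedule is the left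
derivative of the rent function on `(lo, hi]` and its right derivative at `lo`. -/
structure Menu (m : Market) where
  price : ℝ → ℝ
  quality : ℝ → ℝ
  quality_nonneg : ∀ t ∈ Set.Icc m.lo m.hi, 0 ≤ quality t
  ir : ∀ t ∈ Set.Icc m.lo m.hi, 0 ≤ t * quality t - price t
  ic : ∀ t ∈ Set.Icc m.lo m.hi, ∀ s ∈ Set.Icc m.lo m.hi,
    t * quality s - price s ≤ t * quality t - price t
  left_cont : ∀ t ∈ Set.Ioc m.lo m.hi, ContinuousWithinAt quality (Set.Iic t) t
  right_cont_lo : ContinuousWithinAt quality (Set.Ici m.lo) m.lo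

/-- Information rent (utility) of value `t`. -/
def Menu.rent {m : Market} (M : m.Menu) (t : ℝ) : ℝ := t * M.quality t - M.price t

/-- Production cost of quality `q`. -/
def cost (q : ℝ) : ℝ := q ^ 2 / 2

/-- Seller's profit on an off-platform sale to value `t`. -/
def Menu.margin {m : Market} (M : m.Menu) (t : ℝ) : ℝ :=
  t * M.quality t - cost (M.quality t) - M.rent t

/-- Profit from the off-platform consumers, each of whom buys from the seller with the highest
expected value. -/
def offProfit (m : Market) (M : m.Menu) : ℝ :=
  (1 - m.lam) * ∫ t in m.lo..m.hi, M.margin t * m.G t ^ (m.J - 1) * m.g t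

/-- Gross profit without organic links: in addition, the seller sells the efficient quality on the
platform, at a binding showrooming constraint, to the consumers who value it the most. -/
def baselineProfit (m : Market) (M : m.Menu) : ℝ :=
  m.offProfit M
    + m.lam * ∫ t in m.lo..m.hi, (t ^ 2 / 2 - M.rent t) * m.F t ^ (m.J - 1) * m.f t

/-- Equilibrium menu of a seller without organic links. -/
def IsBaselineEquilibrium (m : Market) (M : m.Menu) : Prop :=
  ∀ N : m.Menu, m.baselineProfit N ≤ m.baselineProfit M

/-- Probability that a competitor with menu `V` offers an on-platform consumer a rent `< u`.
If `V.rent` is strictly increasing, this is `F` at the value whose rent is `u`. -/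
def probBelow (m : Market) (V : m.Menu) (u : ℝ) : ℝ :=
  ∫ x in {x ∈ Set.Icc m.lo m.hi | V.rent x < u}, m.f x

/-- Probability that a competitor with menu `V` offers an on-platform consumer a rent `≤ u`.
If `V.rent` is strictly increasing, this is `F` at the value whose rent is `u`. -/
def probAtMost (m : Market) (V : m.Menu) (u : ℝ) : ℝ :=
  ∫ x in {x ∈ Set.Icc m.lo m.hi | V.rent x ≤ u}, m.f x

/-- Gross profit, with organic links, of a seller with menu `M` whose competitors all use the menu `V`.
The second term is the on-platform sales to consumers who value the seller the most and are not offered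
a higher rent elsewhere; the third term is the off-platform sales to on-platform consumers who value
another seller (the advertised one) more, but whom the seller offers the strictly highest rent. -/
def organicProfit (m : Market) (M V : m.Menu) : ℝ :=
  m.offProfit M
    + m.lam * (∫ t in m.lo..m.hi, (t ^ 2 / 2 - M.rent t)
        * min (m.probAtMost V (M.rent t) ^ (m.J - 1)) (m.F t ^ (m.J - 1)) * m.f t)
    + m.lam * (∫ t in m.lo..m.hi, M.margin t
        * max 0 (m.probBelow V (M.rent t) ^ (m.J - 1) - m.F t ^ (m.J - 1)) * m.f t)

/-- Symmetric equilibrium menu with organic links: a best response to itself. -/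
def IsOrganicEquilibrium (m : Market) (M : m.Menu) : Prop :=
  ∀ N : m.Menu, m.organicProfit N M ≤ m.organicProfit M M

/-- Profit with organic links of a seller that does not participate in the campaign and posts the menu
`N`, while the others participate and post `V`: all its sales are off-platform sales. -/
def organicDeviationProfit (m : Market) (N V : m.Menu) : ℝ :=
  ∫ t in m.lo..m.hi, N.margin t
    * ((1 - m.lam) * m.G t ^ (m.J - 1) * m.g t
        + m.lam * m.probBelow V (N.rent t) ^ (m.J - 1) * m.f t)

/-- Seller's outside option without organic links: the best profit from off-platform consumers. -/
def baselineOutside (m : Market) : ℝ := sSup (Set.range fun N : m.Menu => m.offProfit N)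

/-- Seller's outside option with organic links, when the competitors use the menu `V`. -/
def organicOutside (m : Market) (V : m.Menu) : ℝ :=
  sSup (Set.range fun N : m.Menu => m.organicDeviationProfit N V)

/-- Advertising budget without organic links, for the equilibrium menu `M`. -/
def baselineBudget (m : Market) (M : m.Menu) : ℝ := m.baselineProfit M - m.baselineOutside

/-- Advertising budget with organic links, for the equilibrium menu `M`. -/
def organicBudget (m : Market) (M : m.Menu) : ℝ := m.organicProfit M M - m.organicOutside M

end Market

end

/-! Write π for the gross profit without organic links. Two rivals with the same menu never win each
other's advertised consumers: ties go to the advertised seller, and values with a strictly lower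
rent are lower values. So organic links leave the profit at a symmetric profile unchanged
(`organicProfit_self`), and the profit comparison is just the optimality of the baseline menu `B`
for π.

The outside option rises because any menu can be truncated to qualities `min q t` with no rent at
the bottom. This raises every margin and makes it nonnegative, so the extra sales to on-platform
consumers cannot hurt.

The ranking of the menus rests on three properties of π. Modularity (`baselineProfit_sup_add_inf`):
π(M ∨ B) + π(M ∧ B) = π(M) + π(B), with ∨ and ∧ the pointwise max and min of qualities. Local
optimality (`IsOrganicEquilibrium.baselineProfit_le`): π(M ∨ B) ≤ π(M) for an organic equilibrium
`M`. A step of size ε toward M ∨ B raises rents, so no advertised sale is lost; new sales can lose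
only about ε times a winning probability that itself vanishes, and concavity of π turns this
first-order fact into a global one. Uniqueness (`IsBaselineEquilibrium.quality_eq`): π is strictly
concave in qualities when `lam < 1`. The first two give π(M ∧ B) ≥ π(B), the third gives M ∧ B = B
in qualities. When `lam = 1` uniqueness is unavailable, but `B` offers nothing. -/

open Set Filter Topology

/-! ### Distribution functions with a density -/

section Primitive

variable {h : ℝ → ℝ} {a b : ℝ}

theorem IntervalIntegrable.mono_Icc (hi : IntervalIntegrable h volume a b) {s t : ℝ}
    (hs : s ∈ Icc a b) (ht : t ∈ Icc a b) : IntervalIntegrable h volume s t :=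
  hi.mono_set (by
    rw [uIcc_of_le (hs.1.trans hs.2)]
    exact uIcc_subset_Icc hs ht)

theorem primitive_sub_eq (hi : IntervalIntegrable h volume a b) {s t : ℝ}
    (hs : s ∈ Icc a b) (ht : t ∈ Icc a b) :
    (∫ x in a..t, h x) - ∫ x in a..s, h x = ∫ x in s..t, h x := by
  have ha : a ∈ Icc a b := ⟨le_rfl, hs.1.trans hs.2⟩
  exact intervalIntegral.integral_interval_sub_left (hi.mono_Icc ha ht) (hi.mono_Icc ha hs)

theorem integral_nonneg_of_nonneg_Ioo (hn : ∀ x ∈ Ioo a b, 0 ≤ h x) {s t : ℝ}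
    (hs : s ∈ Icc a b) (ht : t ∈ Icc a b) (hst : s ≤ t) : 0 ≤ ∫ x in s..t, h x := by
  rw [intervalIntegral.integral_of_le hst, integral_Ioc_eq_integral_Ioo]
  exact setIntegral_nonneg measurableSet_Ioo
    fun x hx => hn x ⟨hs.1.trans_lt hx.1, hx.2.trans_le ht.2⟩

theorem monotoneOn_primitive (hi : IntervalIntegrable h volume a b)
    (hn : ∀ x ∈ Ioo a b, 0 ≤ h x) : MonotoneOn (fun t => ∫ x in a..t, h x) (Icc a b) := by
  intro s hs t ht hst
  have h1 := primitive_sub_eq hi hs ht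
  have h2 := integral_nonneg_of_nonneg_Ioo hn hs ht hst
  simp only
  linarith

theorem continuousOn_primitive_Icc (hab : a ≤ b) (hi : IntervalIntegrable h volume a b) :
    ContinuousOn (fun t => ∫ x in a..t, h x) (Icc a b) := by
  have := intervalIntegral.continuousOn_primitive_interval (μ := volume) (f := h) (a := a) (b := b)
    (by rwa [← intervalIntegrable_iff'])
  rwa [uIcc_of_le hab] at this

end Primitive

namespace Market

variable {m : Market}

theorem lo_mem (m : Market) : m.lo ∈ Icc m.lo m.hi := ⟨le_rfl, m.lo_lt_hi.le⟩

theorem hi_mem (m : Market) : m.hi ∈ Icc m.lo m.hi := ⟨m.lo_lt_hi.le, le_rfl⟩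

theorem g_nonneg (m : Market) : ∀ x ∈ Ioo m.lo m.hi, 0 ≤ m.g x := fun x hx => (m.g_pos x hx).le

theorem F_lo (m : Market) : m.F m.lo = 0 := intervalIntegral.integral_same

theorem G_lo (m : Market) : m.G m.lo = 0 := intervalIntegral.integral_same

theorem F_hi (m : Market) : m.F m.hi = 1 := m.f_total

theorem G_hi (m : Market) : m.G m.hi = 1 := m.g_total

theorem F_monotoneOn (m : Market) : MonotoneOn m.F (Icc m.lo m.hi) :=
  monotoneOn_primitive m.f_integrable m.f_nonneg

theorem G_monotoneOn (m : Market) : MonotoneOn m.G (Icc m.lo m.hi) :=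
  monotoneOn_primitive m.g_integrable m.g_nonneg

theorem F_continuousOn (m : Market) : ContinuousOn m.F (Icc m.lo m.hi) :=
  continuousOn_primitive_Icc m.lo_lt_hi.le m.f_integrable

theorem G_continuousOn (m : Market) : ContinuousOn m.G (Icc m.lo m.hi) :=
  continuousOn_primitive_Icc m.lo_lt_hi.le m.g_integrable

theorem F_nonneg {t : ℝ} (ht : t ∈ Icc m.lo m.hi) : 0 ≤ m.F t := by
  have := m.F_monotoneOn m.lo_mem ht ht.1
  rwa [F_lo] at this

theorem G_le_one {t : ℝ} (ht : t ∈ Icc m.lo m.hi) : m.G t ≤ 1 := by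
  have := m.G_monotoneOn ht m.hi_mem ht.2
  rwa [G_hi] at this

theorem G_nonneg {t : ℝ} (ht : t ∈ Icc m.lo m.hi) : 0 ≤ m.G t := by
  have := m.G_monotoneOn m.lo_mem ht ht.1
  rwa [G_lo] at this

theorem G_strictMonoOn (m : Market) : StrictMonoOn m.G (Icc m.lo m.hi) := by
  intro s hs t ht hst
  have h1 := primitive_sub_eq m.g_integrable hs ht
  have h2 := intervalIntegral.intervalIntegral_pos_of_pos_on (m.g_integrable.mono_Icc hs ht)
    (fun x hx => m.g_pos x ⟨hs.1.trans_lt hx.1, hx.2.trans_le ht.2⟩) hst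
  simp only [G]
  linarith

theorem G_pos {t : ℝ} (ht : t ∈ Icc m.lo m.hi) (hlt : m.lo < t) : 0 < m.G t := by
  have := m.G_strictMonoOn m.lo_mem ht hlt
  rwa [G_lo] at this

theorem G_lt_one {t : ℝ} (ht : t ∈ Icc m.lo m.hi) (hlt : t < m.hi) : m.G t < 1 := by
  have := m.G_strictMonoOn ht m.hi_mem hlt
  rwa [G_hi] at this

/-- A mean-preserving spread reaches at least as high as the original distribution. -/
theorem F_lt_one {v : ℝ} (hv : v ∈ Icc m.lo m.hi) (hlt : v < m.hi) : m.F v < 1 := by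
  by_contra! hF
  have hsub : ∀ x ∈ Ioo v m.hi, x ∈ Icc m.lo m.hi := fun x hx =>
    ⟨hv.1.trans hx.1.le, hx.2.le⟩
  have hss : Icc v m.hi ⊆ Icc m.lo m.hi := Icc_subset_Icc_left hv.1
  have hle := m.spread_le v hv
  have hFi : IntervalIntegrable m.F volume v m.hi :=
    (m.F_continuousOn.mono hss).intervalIntegrable_of_Icc hlt.le
  have hGi : IntervalIntegrable m.G volume v m.hi :=
    (m.G_continuousOn.mono hss).intervalIntegrable_of_Icc hlt.le
  -- If `F v` were 1, then `F ≥ 1 > G` on `(v, hi)`, against the tail inequality `spread_le`.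
  have hpos := intervalIntegral.intervalIntegral_pos_of_pos_on (hFi.sub hGi) (fun x hx => by
    have h1 := m.F_monotoneOn hv (hsub x hx) hx.1.le
    have h2 := G_lt_one (hsub x hx) hx.2
    show 0 < m.F x - m.G x
    linarith) hlt
  rw [intervalIntegral.integral_sub hFi hGi] at hpos
  change ∫ t in v..m.hi, m.F t ≤ ∫ t in v..m.hi, m.G t at hle
  linarith

/-! ### Bounded measurable weights -/

/-- Bounded measurable functions on the interval of values. -/
def Tame (m : Market) (φ : ℝ → ℝ) : Prop :=
  AEStronglyMeasurable φ (volume.restrict (Icc m.lo m.hi)) ∧ ∃ C, ∀ t ∈ Icc m.lo m.hi, |φ t| ≤ C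

theorem Tame.of_monotoneOn {φ : ℝ → ℝ} (h : MonotoneOn φ (Icc m.lo m.hi)) : m.Tame φ := by
  refine ⟨(aemeasurable_restrict_of_monotoneOn measurableSet_Icc h).aestronglyMeasurable,
    max |φ m.lo| |φ m.hi|, fun t ht => ?_⟩
  exact abs_le_max_abs_abs (h m.lo_mem ht ht.1) (h ht m.hi_mem ht.2)

theorem Tame.const (m : Market) (c : ℝ) : m.Tame fun _ => c :=
  Tame.of_monotoneOn monotoneOn_const

theorem Tame.id (m : Market) : m.Tame fun t => t := Tame.of_monotoneOn fun _ _ _ _ h => h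

theorem Tame.add {φ ψ : ℝ → ℝ} (hφ : m.Tame φ) (hψ : m.Tame ψ) : m.Tame fun t => φ t + ψ t := by
  obtain ⟨h1, C, hC⟩ := hφ
  obtain ⟨h2, D, hD⟩ := hψ
  exact ⟨h1.add h2, C + D, fun t ht => (abs_add_le _ _).trans (add_le_add (hC t ht) (hD t ht))⟩

theorem Tame.mul {φ ψ : ℝ → ℝ} (hφ : m.Tame φ) (hψ : m.Tame ψ) : m.Tame fun t => φ t * ψ t := by
  obtain ⟨h1, C, hC⟩ := hφ
  obtain ⟨h2, D, hD⟩ := hψ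
  refine ⟨h1.mul h2, C * D, fun t ht => ?_⟩
  rw [abs_mul]
  exact mul_le_mul (hC t ht) (hD t ht) (abs_nonneg _) ((abs_nonneg _).trans (hC t ht))

theorem Tame.sub {φ ψ : ℝ → ℝ} (hφ : m.Tame φ) (hψ : m.Tame ψ) : m.Tame fun t => φ t - ψ t := by
  have := hφ.add ((Tame.const m (-1)).mul hψ)
  simpa [sub_eq_add_neg] using this

theorem Tame.pow {φ : ℝ → ℝ} (hφ : m.Tame φ) (n : ℕ) : m.Tame fun t => φ t ^ n := by
  induction n with
  | zero => simpa using Tame.const m 1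
  | succ k ih => simpa [pow_succ] using ih.mul hφ

theorem Tame.max {φ ψ : ℝ → ℝ} (hφ : m.Tame φ) (hψ : m.Tame ψ) :
    m.Tame fun t => max (φ t) (ψ t) := by
  obtain ⟨h1, C, hC⟩ := hφ
  obtain ⟨h2, D, hD⟩ := hψ
  refine ⟨h1.sup h2, Max.max C D, fun t ht => abs_max_le_max_abs_abs.trans ?_⟩
  exact max_le_max (hC t ht) (hD t ht)

theorem Tame.mul_f {φ : ℝ → ℝ} (hφ : m.Tame φ) :
    IntervalIntegrable (fun t => φ t * m.f t) volume m.lo m.hi := by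
  obtain ⟨h1, C, hC⟩ := hφ
  have hf := m.f_integrable
  rw [intervalIntegrable_iff_integrableOn_Icc_of_le m.lo_lt_hi.le] at hf ⊢
  exact Integrable.bdd_mul (c := C) hf h1
    ((ae_restrict_iff' measurableSet_Icc).2 (Eventually.of_forall hC))

theorem Tame.mul_g {φ : ℝ → ℝ} (hφ : m.Tame φ) :
    IntervalIntegrable (fun t => φ t * m.g t) volume m.lo m.hi := by
  obtain ⟨h1, C, hC⟩ := hφ
  have hg := m.g_integrable
  rw [intervalIntegrable_iff_integrableOn_Icc_of_le m.lo_lt_hi.le] at hg ⊢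
  exact Integrable.bdd_mul (c := C) hg h1
    ((ae_restrict_iff' measurableSet_Icc).2 (Eventually.of_forall hC))

theorem tame_F (m : Market) : m.Tame m.F := Tame.of_monotoneOn m.F_monotoneOn

theorem tame_G (m : Market) : m.Tame m.G := Tame.of_monotoneOn m.G_monotoneOn

/-! ### Menus -/

namespace Menu

theorem rent_nonneg (A : m.Menu) {t : ℝ} (ht : t ∈ Icc m.lo m.hi) : 0 ≤ A.rent t := A.ir t ht

theorem rent_add_le (A : m.Menu) {s t : ℝ} (hs : s ∈ Icc m.lo m.hi) (ht : t ∈ Icc m.lo m.hi) :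
    A.rent s + (t - s) * A.quality s ≤ A.rent t := by
  have := A.ic t ht s hs
  simp only [rent]
  linarith

theorem quality_monotoneOn (A : m.Menu) : MonotoneOn A.quality (Icc m.lo m.hi) := by
  intro s hs t ht hst
  rcases hst.eq_or_lt with rfl | hlt
  · exact le_rfl
  have h1 := A.rent_add_le hs ht
  have h2 := A.rent_add_le ht hs
  nlinarith

theorem rent_monotoneOn (A : m.Menu) : MonotoneOn A.rent (Icc m.lo m.hi) := by
  intro s hs t ht hst
  have h1 := A.rent_add_le hs ht
  have h2 := mul_nonneg (sub_nonneg.2 hst) (A.quality_nonneg s hs)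
  linarith

theorem tame_quality (A : m.Menu) : m.Tame A.quality := Tame.of_monotoneOn A.quality_monotoneOn

theorem tame_rent (A : m.Menu) : m.Tame A.rent := Tame.of_monotoneOn A.rent_monotoneOn

theorem margin_eq (A : m.Menu) (t : ℝ) :
    A.margin t = t * A.quality t - A.quality t ^ 2 / 2 - A.rent t := rfl

theorem margin_eq_price_sub_cost (A : m.Menu) (t : ℝ) :
    A.margin t = A.price t - cost (A.quality t) := by
  simp only [margin, rent]
  ring

theorem tame_margin (A : m.Menu) : m.Tame A.margin := by
  have := (((Tame.id m).mul A.tame_quality).sub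
    ((Tame.const m (1 / 2)).mul (A.tame_quality.pow 2))).sub A.tame_rent
  convert this using 2 with t
  rw [margin_eq]
  ring

theorem margin_le (A : m.Menu) {t : ℝ} (ht : t ∈ Icc m.lo m.hi) : A.margin t ≤ m.hi ^ 2 / 2 := by
  have h1 := A.rent_nonneg ht
  have h2 := m.lo_nonneg
  have h3 : t ^ 2 ≤ m.hi ^ 2 := pow_le_pow_left₀ (h2.trans ht.1) ht.2 2
  rw [margin_eq]
  nlinarith [sq_nonneg (t - A.quality t)]

theorem intervalIntegrable_quality (A : m.Menu) {s t : ℝ} (hs : s ∈ Icc m.lo m.hi)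
    (ht : t ∈ Icc m.lo m.hi) : IntervalIntegrable A.quality volume s t :=
  (A.quality_monotoneOn.mono (uIcc_subset_Icc hs ht)).intervalIntegrable

end Menu

theorem integral_bounds_of_monotoneOn {q : ℝ → ℝ} {a b : ℝ} (hq : MonotoneOn q (Icc a b))
    {s t : ℝ} (hs : s ∈ Icc a b) (ht : t ∈ Icc a b) (hst : s ≤ t) :
    (t - s) * q s ≤ ∫ x in s..t, q x ∧ ∫ x in s..t, q x ≤ (t - s) * q t := by
  have hi : IntervalIntegrable q volume s t :=
    (hq.mono (uIcc_subset_Icc hs ht)).intervalIntegrable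
  have hmem : ∀ x ∈ Icc s t, x ∈ Icc a b := fun x hx => ⟨hs.1.trans hx.1, hx.2.trans ht.2⟩
  constructor
  · have := intervalIntegral.integral_mono_on hst (intervalIntegrable_const (c := q s)) hi
      fun x hx => hq hs (hmem x hx) hx.1
    simpa using this
  · have := intervalIntegral.integral_mono_on hst hi (intervalIntegrable_const (c := q t))
      fun x hx => hq (hmem x hx) ht hx.2
    simpa using this

namespace Menu

/-- The rent increment and the integral both lie between `(t - s) * q s` and `(t - s) * q t`.
Bisection halves the lengths while the quality increments telescope, so each round halves the error
bound. This yields the envelope formula without differentiating the rent. -/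
theorem abs_rent_sub_integral_le (A : m.Menu) (n : ℕ) :
    ∀ s ∈ Icc m.lo m.hi, ∀ t ∈ Icc m.lo m.hi, s ≤ t →
      |A.rent t - A.rent s - ∫ x in s..t, A.quality x|
        ≤ (t - s) * (A.quality t - A.quality s) / 2 ^ n := by
  induction n with
  | zero =>
    intro s hs t ht hst
    obtain ⟨h1, h2⟩ := integral_bounds_of_monotoneOn A.quality_monotoneOn hs ht hst
    have h3 := A.rent_add_le hs ht
    have h4 := A.rent_add_le ht hs
    rw [abs_le, pow_zero, div_one]
    constructor <;> linarith
  | succ n ih =>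
    intro s hs t ht hst
    have hc : (s + t) / 2 ∈ Icc m.lo m.hi :=
      ⟨by linarith [hs.1, ht.1], by linarith [hs.2, ht.2]⟩
    have h1 := ih s hs _ hc (by linarith)
    have h2 := ih _ hc t ht (by linarith)
    have h3 := intervalIntegral.integral_add_adjacent_intervals
      (A.intervalIntegrable_quality hs hc) (A.intervalIntegrable_quality hc ht)
    have h4 := abs_add_le (A.rent ((s + t) / 2) - A.rent s - ∫ x in s..(s + t) / 2, A.quality x)
      (A.rent t - A.rent ((s + t) / 2) - ∫ x in (s + t) / 2..t, A.quality x)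
    rw [← h3]
    calc _ = _ := by congr 1; ring
      _ ≤ _ := h4
      _ ≤ _ := add_le_add h1 h2
      _ = _ := by rw [pow_succ]; field_simp; ring

/-- The envelope formula. -/
theorem rent_eq (A : m.Menu) {t : ℝ} (ht : t ∈ Icc m.lo m.hi) :
    A.rent t = A.rent m.lo + ∫ x in m.lo..t, A.quality x := by
  have hlim : Tendsto (fun n : ℕ => (t - m.lo) * (A.quality t - A.quality m.lo) / 2 ^ n)
      atTop (𝓝 0) :=
    tendsto_const_nhds.div_atTop (tendsto_pow_atTop_atTop_of_one_lt one_lt_two)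
  have h0 := ge_of_tendsto' hlim fun n =>
    A.abs_rent_sub_integral_le n m.lo m.lo_mem t ht ht.1
  have := abs_nonpos_iff.1 h0
  linarith

/-- The menu with a given quality schedule and a given rent of the lowest value. -/
noncomputable def ofQuality (m : Market) (q : ℝ → ℝ) (u : ℝ) (hu : 0 ≤ u)
    (hq : ∀ t ∈ Icc m.lo m.hi, 0 ≤ q t) (hmono : MonotoneOn q (Icc m.lo m.hi))
    (hl : ∀ t ∈ Ioc m.lo m.hi, ContinuousWithinAt q (Iic t) t)
    (hr : ContinuousWithinAt q (Ici m.lo) m.lo) : m.Menu where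
  price t := t * q t - (u + ∫ x in m.lo..t, q x)
  quality := q
  quality_nonneg := hq
  ir t ht := by
    have h1 := (integral_bounds_of_monotoneOn hmono m.lo_mem ht ht.1).1
    have h2 := mul_nonneg (sub_nonneg.2 ht.1) (hq _ m.lo_mem)
    linarith
  ic t ht s hs := by
    have hi : ∀ {x y : ℝ}, x ∈ Icc m.lo m.hi → y ∈ Icc m.lo m.hi →
        IntervalIntegrable q volume x y := fun hx hy =>
      (hmono.mono (uIcc_subset_Icc hx hy)).intervalIntegrable
    rcases le_total s t with hst | hst
    · have h1 := (integral_bounds_of_monotoneOn hmono hs ht hst).1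
      have h2 := intervalIntegral.integral_interval_sub_left (hi m.lo_mem ht) (hi m.lo_mem hs)
      linarith
    · have h1 := (integral_bounds_of_monotoneOn hmono ht hs hst).2
      have h2 := intervalIntegral.integral_interval_sub_left (hi m.lo_mem hs) (hi m.lo_mem ht)
      linarith
  left_cont := hl
  right_cont_lo := hr

/-- The menu with the higher of two qualities for each value. -/
noncomputable def sup (A B : m.Menu) (u : ℝ) (hu : 0 ≤ u) : m.Menu :=
  ofQuality m (fun t => max (A.quality t) (B.quality t)) u hu
    (fun t ht => le_max_of_le_left (A.quality_nonneg t ht))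
    (A.quality_monotoneOn.sup B.quality_monotoneOn)
    (fun t ht => (A.left_cont t ht).max (B.left_cont t ht))
    (A.right_cont_lo.max B.right_cont_lo)

/-- The menu with the lower of two qualities for each value. -/
noncomputable def inf (A B : m.Menu) (u : ℝ) (hu : 0 ≤ u) : m.Menu :=
  ofQuality m (fun t => min (A.quality t) (B.quality t)) u hu
    (fun t ht => le_min (A.quality_nonneg t ht) (B.quality_nonneg t ht))
    (A.quality_monotoneOn.inf B.quality_monotoneOn)
    (fun t ht => (A.left_cont t ht).min (B.left_cont t ht))
    (A.right_cont_lo.min B.right_cont_lo)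

/-- The menu without rent for the lowest value whose qualities are capped at the efficient ones. -/
noncomputable def truncate (A : m.Menu) : m.Menu :=
  ofQuality m (fun t => min (A.quality t) t) 0 le_rfl
    (fun t ht => le_min (A.quality_nonneg t ht) (m.lo_nonneg.trans ht.1))
    (A.quality_monotoneOn.inf fun _ _ _ _ h => h)
    (fun t ht => (A.left_cont t ht).min continuousWithinAt_id)
    (A.right_cont_lo.min continuousWithinAt_id)

/-- The menu with the same qualities and no rent for the lowest value. -/
noncomputable def dropRent (A : m.Menu) : m.Menu :=
  ofQuality m A.quality 0 le_rfl A.quality_nonneg A.quality_monotoneOn A.left_cont A.right_cont_lo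

/-- The menu that offers nothing. -/
noncomputable def null (m : Market) : m.Menu :=
  ofQuality m (fun _ => 0) 0 le_rfl (fun _ _ => le_rfl) monotoneOn_const
    (fun _ _ => continuousWithinAt_const) continuousWithinAt_const

/-- The convex combination of two menus. -/
noncomputable def mix (e : ℝ) (h0 : 0 ≤ e) (h1 : e ≤ 1) (A B : m.Menu) : m.Menu where
  price t := (1 - e) * A.price t + e * B.price t
  quality t := (1 - e) * A.quality t + e * B.quality t
  quality_nonneg t ht := add_nonneg (mul_nonneg (sub_nonneg.2 h1) (A.quality_nonneg t ht))
    (mul_nonneg h0 (B.quality_nonneg t ht))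
  ir t ht := by
    have := mul_nonneg (sub_nonneg.2 h1) (A.ir t ht)
    have := mul_nonneg h0 (B.ir t ht)
    linarith
  ic t ht s hs := by
    have := mul_le_mul_of_nonneg_left (A.ic t ht s hs) (sub_nonneg.2 h1)
    have := mul_le_mul_of_nonneg_left (B.ic t ht s hs) h0
    linarith
  left_cont t ht := ((A.left_cont t ht).const_mul _).add ((B.left_cont t ht).const_mul _)
  right_cont_lo := (A.right_cont_lo.const_mul _).add (B.right_cont_lo.const_mul _)

theorem mix_rent {e : ℝ} (h0 : 0 ≤ e) (h1 : e ≤ 1) (A B : m.Menu) (t : ℝ) :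
    (mix e h0 h1 A B).rent t = (1 - e) * A.rent t + e * B.rent t := by
  simp only [mix, rent]
  ring

/-- The square is the saving from convex production costs; all else in the margin is linear along
the mixture. -/
theorem mix_margin {e : ℝ} (h0 : 0 ≤ e) (h1 : e ≤ 1) (A B : m.Menu) (t : ℝ) :
    (mix e h0 h1 A B).margin t = (1 - e) * A.margin t + e * B.margin t
      + e * (1 - e) / 2 * (A.quality t - B.quality t) ^ 2 := by
  rw [margin_eq, mix_rent, margin_eq, margin_eq]
  simp only [mix]
  ring

section ofQuality

variable {q : ℝ → ℝ} {u : ℝ} {hu : 0 ≤ u} {hq : ∀ t ∈ Icc m.lo m.hi, 0 ≤ q t}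
  {hmono : MonotoneOn q (Icc m.lo m.hi)}
  {hl : ∀ t ∈ Ioc m.lo m.hi, ContinuousWithinAt q (Iic t) t}
  {hr : ContinuousWithinAt q (Ici m.lo) m.lo}

theorem ofQuality_rent (t : ℝ) :
    (ofQuality m q u hu hq hmono hl hr).rent t = u + ∫ x in m.lo..t, q x := by
  simp only [ofQuality, rent]
  ring

end ofQuality

theorem sup_rent (A B : m.Menu) {u : ℝ} (hu : 0 ≤ u) (t : ℝ) :
    (sup A B u hu).rent t = u + ∫ x in m.lo..t, max (A.quality x) (B.quality x) :=
  ofQuality_rent t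

theorem inf_rent (A B : m.Menu) {u : ℝ} (hu : 0 ≤ u) (t : ℝ) :
    (inf A B u hu).rent t = u + ∫ x in m.lo..t, min (A.quality x) (B.quality x) :=
  ofQuality_rent t

theorem truncate_rent (A : m.Menu) (t : ℝ) :
    A.truncate.rent t = ∫ x in m.lo..t, min (A.quality x) x :=
  (ofQuality_rent t).trans (zero_add _)

theorem dropRent_rent (A : m.Menu) {t : ℝ} (ht : t ∈ Icc m.lo m.hi) :
    A.dropRent.rent t = A.rent t - A.rent m.lo := by
  rw [dropRent, ofQuality_rent, A.rent_eq ht]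
  ring

theorem null_rent (m : Market) (t : ℝ) : (null m).rent t = 0 := by
  rw [null, ofQuality_rent]
  simp

theorem rent_le_truncate_rent (A : m.Menu) {t : ℝ} (ht : t ∈ Icc m.lo m.hi) :
    A.truncate.rent t ≤ A.rent t := by
  rw [truncate_rent, A.rent_eq ht]
  have h1 := A.rent_nonneg m.lo_mem
  have h2 := intervalIntegral.integral_mono_on ht.1
    (A.truncate.intervalIntegrable_quality m.lo_mem ht)
    (A.intervalIntegrable_quality m.lo_mem ht) fun x _ => min_le_left _ _
  have h3 : ∫ x in m.lo..t, A.truncate.quality x = ∫ x in m.lo..t, min (A.quality x) x := rfl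
  linarith

/-- With `q` the truncated quality at `t`, qualities at `x ≤ t` are at most `min q x`. Hence the
rent at `t` is at most `∫ min q x` over `[0, t]`, which equals the whole surplus `t * q - q ^ 2 /
2`. -/
theorem truncate_margin_nonneg (A : m.Menu) {t : ℝ} (ht : t ∈ Icc m.lo m.hi) :
    0 ≤ A.truncate.margin t := by
  set q := min (A.quality t) t with hq
  have hqt : A.truncate.quality t = q := rfl
  have hq0 : 0 ≤ q := A.truncate.quality_nonneg t ht
  have hqle : q ≤ t := min_le_right _ _
  have hi : ∀ x y : ℝ, IntervalIntegrable (fun x => min q x) volume x y := fun x y =>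
    (continuous_const.min continuous_id).intervalIntegrable x y
  have h1 : ∫ x in m.lo..t, min (A.quality x) x ≤ ∫ x in m.lo..t, min q x := by
    refine intervalIntegral.integral_mono_on ht.1
      (A.truncate.intervalIntegrable_quality m.lo_mem ht) (hi _ _) fun x hx => ?_
    exact le_min (A.truncate.quality_monotoneOn ⟨hx.1, hx.2.trans ht.2⟩ ht hx.2)
      (min_le_right _ _)
  have h2 : ∫ x in m.lo..t, min q x ≤ ∫ x in (0 : ℝ)..t, min q x := by
    rw [← intervalIntegral.integral_add_adjacent_intervals (hi 0 m.lo) (hi m.lo t)]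
    have := intervalIntegral.integral_nonneg m.lo_nonneg (μ := volume)
      (f := fun x => min q x) fun x hx => le_min hq0 hx.1
    linarith
  have h3 : ∫ x in (0 : ℝ)..t, min q x = t * q - q ^ 2 / 2 := by
    rw [← intervalIntegral.integral_add_adjacent_intervals (hi 0 q) (hi q t)]
    have e1 : ∫ x in (0 : ℝ)..q, min q x = ∫ x in (0 : ℝ)..q, x := by
      refine intervalIntegral.integral_congr fun x hx => ?_
      rw [uIcc_of_le hq0] at hx
      exact min_eq_right hx.2
    have e2 : ∫ x in q..t, min q x = ∫ _ in q..t, q := by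
      refine intervalIntegral.integral_congr fun x hx => ?_
      rw [uIcc_of_le hqle] at hx
      exact min_eq_left hx.1
    rw [e1, e2, integral_id, intervalIntegral.integral_const, smul_eq_mul]
    ring
  rw [margin_eq, truncate_rent, hqt]
  linarith

/-- Quality beyond the efficient level `t` only destroys surplus, and truncation lowers the rent. -/
theorem margin_le_truncate_margin (A : m.Menu) {t : ℝ} (ht : t ∈ Icc m.lo m.hi) :
    A.margin t ≤ A.truncate.margin t := by
  have h := A.rent_le_truncate_rent ht
  rw [margin_eq, margin_eq]
  have hq : A.truncate.quality t = min (A.quality t) t := rfl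
  rw [hq]
  rcases le_total (A.quality t) t with h1 | h1
  · rw [min_eq_left h1]; linarith
  · rw [min_eq_right h1]; nlinarith [sq_nonneg (A.quality t - t)]

/-- Qualities that are ordered almost everywhere are ordered everywhere. -/
theorem quality_le_of_ae (A B : m.Menu)
    (h : ∀ᵐ t, t ∈ Ioo m.lo m.hi → A.quality t ≤ B.quality t) {t : ℝ}
    (ht : t ∈ Icc m.lo m.hi) : A.quality t ≤ B.quality t := by
  have key : ∀ a b : ℝ, a < b → Ioo a b ⊆ Ioo m.lo m.hi →
      ∃ x ∈ Ioo a b, A.quality x ≤ B.quality x := by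
    intro a b hab hsub
    by_contra! hcon
    have h0 : volume (Ioo a b) = 0 := by
      refine measure_mono_null (fun x hx => ?_) (ae_iff.1 h)
      simp only [mem_ofPred_eq, Classical.not_imp, not_le]
      exact ⟨hsub hx, hcon x hx⟩
    rw [Real.volume_Ioo, ENNReal.ofReal_eq_zero] at h0
    linarith
  -- A strict violation at `t` persists, by one-sided continuity, on an interval to the left of `t`
  -- (to the right if `t = lo`), which has positive measure.
  by_contra! hlt
  rcases ht.1.eq_or_lt with rfl | hlo
  · have h1 := (B.right_cont_lo.eventually_lt A.right_cont_lo hlt).filter_mono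
      (nhdsWithin_mono _ Ioi_subset_Ici_self)
    obtain ⟨c, hc, hcs⟩ := mem_nhdsGT_iff_exists_Ioo_subset.1 h1
    obtain ⟨x, hx, hxle⟩ := key m.lo (min c m.hi) (lt_min hc m.lo_lt_hi)
      fun x hx => ⟨hx.1, hx.2.trans_le (min_le_right _ _)⟩
    exact absurd (hcs ⟨hx.1, hx.2.trans_le (min_le_left _ _)⟩) (not_lt.2 hxle)
  · have h1 := ((B.left_cont t ⟨hlo, ht.2⟩).eventually_lt (A.left_cont t ⟨hlo, ht.2⟩)
      hlt).filter_mono (nhdsWithin_mono _ Iio_subset_Iic_self)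
    obtain ⟨c, hc, hcs⟩ := mem_nhdsLT_iff_exists_Ioo_subset.1 h1
    obtain ⟨x, hx, hxle⟩ := key (max c m.lo) t (max_lt hc hlo)
      fun x hx => ⟨(le_max_right _ _).trans_lt hx.1, hx.2.trans_le ht.2⟩
    exact absurd (hcs ⟨(le_max_left _ _).trans_lt hx.1, hx.2⟩) (not_lt.2 hxle)

end Menu

/-! ### Rents offered by a competitor -/

theorem integrableOn_f (m : Market) : IntegrableOn m.f (Icc m.lo m.hi) :=
  (intervalIntegrable_iff_integrableOn_Icc_of_le m.lo_lt_hi.le).1 m.f_integrable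

theorem ae_nonneg_f (m : Market) : 0 ≤ᵐ[volume.restrict (Icc m.lo m.hi)] m.f := by
  rw [restrict_Ioo_eq_restrict_Icc.symm]
  exact (ae_restrict_iff' measurableSet_Ioo).2 (Eventually.of_forall m.f_nonneg)

theorem setIntegral_f_mono {s t : Set ℝ} (hst : s ⊆ t) (ht : t ⊆ Icc m.lo m.hi) :
    ∫ x in s, m.f x ≤ ∫ x in t, m.f x :=
  setIntegral_mono_set (m.integrableOn_f.mono_set ht)
    (ae_restrict_of_ae_restrict_of_subset ht m.ae_nonneg_f) (Eventually.of_forall hst)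

theorem setIntegral_f_Icc {t : ℝ} (ht : t ∈ Icc m.lo m.hi) :
    ∫ x in Icc m.lo t, m.f x = m.F t := by
  rw [integral_Icc_eq_integral_Ioc, F, intervalIntegral.integral_of_le ht.1]

theorem probBelow_nonneg (V : m.Menu) (u : ℝ) : 0 ≤ m.probBelow V u := by
  have := setIntegral_f_mono (m := m) (empty_subset {x ∈ Icc m.lo m.hi | V.rent x < u})
    fun x hx => hx.1
  rwa [setIntegral_empty] at this

theorem probBelow_le_F (V : m.Menu) {u s : ℝ} (hs : s ∈ Icc m.lo m.hi)
    (h : ∀ x ∈ Icc m.lo m.hi, V.rent x < u → x ≤ s) : m.probBelow V u ≤ m.F s := by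
  rw [← setIntegral_f_Icc hs]
  exact setIntegral_f_mono (fun x hx => ⟨hx.1.1, h x hx.1 hx.2⟩) (Icc_subset_Icc_right hs.2)

theorem probBelow_le_one (V : m.Menu) (u : ℝ) : m.probBelow V u ≤ 1 := by
  rw [← m.F_hi]
  exact probBelow_le_F V m.hi_mem fun x hx _ => hx.2

theorem probBelow_mono (V : m.Menu) : Monotone (m.probBelow V) := fun _ _ huv =>
  setIntegral_f_mono (fun _ hx => ⟨hx.1, hx.2.trans_le huv⟩) fun _ hx => hx.1

theorem F_le_probAtMost (V : m.Menu) {u t : ℝ} (ht : t ∈ Icc m.lo m.hi) (h : V.rent t ≤ u) :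
    m.F t ≤ m.probAtMost V u := by
  rw [← setIntegral_f_Icc ht]
  refine setIntegral_f_mono (fun x hx => ?_) fun x hx => hx.1
  have hx' : x ∈ Icc m.lo m.hi := ⟨hx.1, hx.2.trans ht.2⟩
  exact ⟨hx', (V.rent_monotoneOn hx' ht hx.2).trans h⟩

theorem probBelow_rent_le_F (V : m.Menu) {t : ℝ} (ht : t ∈ Icc m.lo m.hi) :
    m.probBelow V (V.rent t) ≤ m.F t :=
  probBelow_le_F V ht fun _ hx hlt =>
    le_of_not_gt fun hgt => absurd (V.rent_monotoneOn ht hx hgt.le) (not_le.2 hlt)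

theorem tame_probBelow (V N : m.Menu) : m.Tame fun t => m.probBelow V (N.rent t) :=
  Tame.of_monotoneOn fun _ hs _ ht hst => probBelow_mono V (N.rent_monotoneOn hs ht hst)

/-- Above `t` the rent grows at rate at least `V.quality t > 0`, so a rent below `V.rent t + e`
forces a value at most `t + e / V.quality t`; continuity of `F` does the rest. Where the quality is
zero the rent may be flat and the probability may jump. -/
theorem tendsto_probBelow (V : m.Menu) {t : ℝ} (ht : t ∈ Icc m.lo m.hi) (hq : 0 < V.quality t)
    {e : ℕ → ℝ} (he0 : ∀ n, 0 ≤ e n) (he : Tendsto e atTop (𝓝 0)) :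
    ∃ P : ℕ → ℝ, Tendsto P atTop (𝓝 (m.F t)) ∧ ∀ n, m.probBelow V (V.rent t + e n) ≤ P n := by
  set s : ℕ → ℝ := fun n => min m.hi (t + e n / V.quality t) with hs
  have hmem : ∀ n, s n ∈ Icc m.lo m.hi := fun n =>
    ⟨le_min m.lo_lt_hi.le (ht.1.trans (le_add_of_nonneg_right (div_nonneg (he0 n) hq.le))),
      min_le_left _ _⟩
  have hlim : Tendsto s atTop (𝓝 t) := by
    have h1 := (tendsto_const_nhds (x := m.hi)).min
      ((he.div_const (V.quality t)).const_add t)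
    rwa [zero_div, add_zero, min_eq_right ht.2] at h1
  refine ⟨fun n => m.F (s n), (m.F_continuousOn t ht).tendsto.comp
    (tendsto_nhdsWithin_iff.2 ⟨hlim, Eventually.of_forall hmem⟩), fun n => ?_⟩
  refine probBelow_le_F V (hmem n) fun x hx hlt => le_min hx.2 ?_
  have h1 := V.rent_add_le ht hx
  rw [← sub_le_iff_le_add', le_div_iff₀ hq]
  linarith

/-! ### Profits -/

theorem intervalIntegrable_off (A : m.Menu) :
    IntervalIntegrable (fun t => A.margin t * m.G t ^ (m.J - 1) * m.g t) volume m.lo m.hi :=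
  (A.tame_margin.mul (m.tame_G.pow _)).mul_g

theorem tame_surplus_sub_rent (A : m.Menu) : m.Tame fun t => t ^ 2 / 2 - A.rent t := by
  have := ((Tame.const m (1 / 2)).mul ((Tame.id m).pow 2)).sub A.tame_rent
  convert this using 2 with t
  ring

theorem intervalIntegrable_on (A : m.Menu) :
    IntervalIntegrable (fun t => (t ^ 2 / 2 - A.rent t) * m.F t ^ (m.J - 1) * m.f t)
      volume m.lo m.hi :=
  ((tame_surplus_sub_rent A).mul (m.tame_F.pow _)).mul_f

/-- Contribution of value `t` to the gross profit without organic links. -/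
noncomputable def baselineIntegrand (m : Market) (A : m.Menu) (t : ℝ) : ℝ :=
  (1 - m.lam) * (A.margin t * m.G t ^ (m.J - 1) * m.g t)
    + m.lam * ((t ^ 2 / 2 - A.rent t) * m.F t ^ (m.J - 1) * m.f t)

theorem intervalIntegrable_baselineIntegrand (A : m.Menu) :
    IntervalIntegrable (m.baselineIntegrand A) volume m.lo m.hi :=
  ((intervalIntegrable_off A).const_mul _).add ((intervalIntegrable_on A).const_mul _)

theorem baselineProfit_eq (A : m.Menu) :
    m.baselineProfit A = ∫ t in m.lo..m.hi, m.baselineIntegrand A t := by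
  simp only [baselineIntegrand]
  rw [intervalIntegral.integral_add ((intervalIntegrable_off A).const_mul _)
    ((intervalIntegrable_on A).const_mul _), intervalIntegral.integral_const_mul,
    intervalIntegral.integral_const_mul]
  rfl

theorem intervalIntegrable_sq (A B : m.Menu) :
    IntervalIntegrable (fun t => (A.quality t - B.quality t) ^ 2 * m.G t ^ (m.J - 1) * m.g t)
      volume m.lo m.hi :=
  (((A.tame_quality.sub B.tame_quality).pow 2).mul (m.tame_G.pow _)).mul_g

/-- On-platform profit is linear in the rent, so the strict part of the concavity comes from
off-platform sales alone and disappears at `lam = 1`. -/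
theorem baselineProfit_mix {e : ℝ} (h0 : 0 ≤ e) (h1 : e ≤ 1) (A B : m.Menu) :
    m.baselineProfit (Menu.mix e h0 h1 A B)
      = (1 - e) * m.baselineProfit A + e * m.baselineProfit B
        + e * (1 - e) / 2 * (1 - m.lam) * ∫ t in m.lo..m.hi,
          (A.quality t - B.quality t) ^ 2 * m.G t ^ (m.J - 1) * m.g t := by
  have hA := (intervalIntegrable_baselineIntegrand A).const_mul (1 - e)
  have hB := (intervalIntegrable_baselineIntegrand B).const_mul e
  simp only [baselineProfit_eq]
  rw [← intervalIntegral.integral_const_mul, ← intervalIntegral.integral_const_mul,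
    ← intervalIntegral.integral_const_mul, ← intervalIntegral.integral_add hA hB,
    ← intervalIntegral.integral_add (hA.add hB) ((intervalIntegrable_sq A B).const_mul _)]
  refine intervalIntegral.integral_congr fun t _ => ?_
  simp only [baselineIntegrand, Menu.mix_margin, Menu.mix_rent]
  ring

theorem baselineProfit_le_of_le {A B : m.Menu}
    (hr : ∀ t ∈ Icc m.lo m.hi, B.rent t ≤ A.rent t)
    (hm : ∀ t ∈ Icc m.lo m.hi, A.margin t ≤ B.margin t) :
    m.baselineProfit A ≤ m.baselineProfit B := by
  rw [baselineProfit_eq, baselineProfit_eq]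
  refine intervalIntegral.integral_mono_on_of_le_Ioo m.lo_lt_hi.le
    (intervalIntegrable_baselineIntegrand A) (intervalIntegrable_baselineIntegrand B)
    fun t ht => ?_
  have ht' := Ioo_subset_Icc_self ht
  have hl := m.lam_nonneg
  have hl' := sub_nonneg.2 m.lam_le_one
  have hF := pow_nonneg (F_nonneg ht') (m.J - 1)
  have hG := pow_nonneg (G_nonneg ht') (m.J - 1)
  have hf := m.f_nonneg t ht
  have hg := m.g_nonneg t ht
  have h1 := hr t ht'
  have h2 := hm t ht'
  simp only [baselineIntegrand]
  gcongr

/-! ### Equilibria without organic links. -/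

/-- The equilibrium qualities without organic links are unique. -/
theorem IsBaselineEquilibrium.quality_eq {A B : m.Menu} (hB : m.IsBaselineEquilibrium B)
    (hlam : m.lam < 1) (hA : m.baselineProfit B ≤ m.baselineProfit A) {t : ℝ}
    (ht : t ∈ Icc m.lo m.hi) : A.quality t = B.quality t := by
  have hint := intervalIntegrable_sq A B
  have hnn : ∀ t ∈ Ioo m.lo m.hi,
      0 ≤ (A.quality t - B.quality t) ^ 2 * m.G t ^ (m.J - 1) * m.g t := fun t ht =>
    mul_nonneg (mul_nonneg (sq_nonneg _) (pow_nonneg (G_nonneg (Ioo_subset_Icc_self ht)) _))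
      (m.g_nonneg t ht)
  -- The midpoint beats `B` by at least a positive multiple of the weighted squared distance, which
  -- must therefore vanish.
  have hmix := baselineProfit_mix (e := 1 / 2) (by norm_num) (by norm_num) A B
  have hopt := hB (Menu.mix (1 / 2) (by norm_num) (by norm_num) A B)
  have h0 : ∫ t in m.lo..m.hi,
      (A.quality t - B.quality t) ^ 2 * m.G t ^ (m.J - 1) * m.g t = 0 := by
    refine le_antisymm ?_ (integral_nonneg_of_nonneg_Ioo hnn m.lo_mem m.hi_mem m.lo_lt_hi.le)
    have := sub_pos.2 hlam
    by_contra! hpos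
    have := mul_pos this hpos
    linarith
  rw [intervalIntegral.integral_of_le m.lo_lt_hi.le, integral_Ioc_eq_integral_Ioo,
    setIntegral_eq_zero_iff_of_nonneg_ae
      ((ae_restrict_iff' measurableSet_Ioo).2 (Eventually.of_forall hnn))
      ((intervalIntegrable_iff_integrableOn_Ioo_of_le m.lo_lt_hi.le).1 hint)] at h0
  have hae : ∀ᵐ t, t ∈ Ioo m.lo m.hi → A.quality t = B.quality t := by
    filter_upwards [(ae_restrict_iff' measurableSet_Ioo).1 h0] with t h ht
    have h1 := h ht
    have hG := (pow_pos (G_pos (Ioo_subset_Icc_self ht) ht.1) (m.J - 1)).ne'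
    have hg := (m.g_pos t ht).ne'
    simpa [hG, hg, sub_eq_zero] using h1
  exact le_antisymm (A.quality_le_of_ae B (hae.mono fun t h ht => (h ht).le) ht)
    (B.quality_le_of_ae A (hae.mono fun t h ht => (h ht).ge) ht)

/-- A rent granted to all values alike can be withdrawn without touching any quality, and
off-platform sales make this strictly profitable. -/
theorem IsBaselineEquilibrium.rent_lo {B : m.Menu} (hB : m.IsBaselineEquilibrium B)
    (hlam : m.lam < 1) : B.rent m.lo = 0 := by
  have hopt := hB B.dropRent
  rw [baselineProfit_eq, baselineProfit_eq] at hopt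
  by_contra hne
  have hpos : 0 < B.rent m.lo := lt_of_le_of_ne (B.rent_nonneg m.lo_mem) (Ne.symm hne)
  have hA := intervalIntegrable_baselineIntegrand B.dropRent
  have hB' := intervalIntegrable_baselineIntegrand B
  have h := intervalIntegral.intervalIntegral_pos_of_pos_on (hA.sub hB') (fun t ht => by
    have ht' := Ioo_subset_Icc_self ht
    have hq : B.dropRent.quality t = B.quality t := rfl
    have e : m.baselineIntegrand B.dropRent t - m.baselineIntegrand B t
        = B.rent m.lo * ((1 - m.lam) * (m.G t ^ (m.J - 1) * m.g t)
          + m.lam * (m.F t ^ (m.J - 1) * m.f t)) := by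
      simp only [baselineIntegrand, Menu.margin_eq, hq, B.dropRent_rent ht']
      ring
    have h1 : 0 < (1 - m.lam) * (m.G t ^ (m.J - 1) * m.g t) :=
      mul_pos (sub_pos.2 hlam) (mul_pos (pow_pos (G_pos ht' ht.1) _) (m.g_pos t ht))
    have h2 : 0 ≤ m.lam * (m.F t ^ (m.J - 1) * m.f t) :=
      mul_nonneg m.lam_nonneg (mul_nonneg (pow_nonneg (F_nonneg ht') _) (m.f_nonneg t ht))
    show 0 < m.baselineIntegrand B.dropRent t - m.baselineIntegrand B t
    rw [e]
    exact mul_pos hpos (by linarith)) m.lo_lt_hi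
  rw [intervalIntegral.integral_sub hA hB'] at h
  linarith

/-- Truncation does not lower the profit, so by uniqueness it changes no quality, and `B` inherits
the nonnegative margins of its truncation. -/
theorem IsBaselineEquilibrium.margin_nonneg {B : m.Menu} (hB : m.IsBaselineEquilibrium B)
    (hlam : m.lam < 1) {t : ℝ} (ht : t ∈ Icc m.lo m.hi) : 0 ≤ B.margin t := by
  have hle : m.baselineProfit B ≤ m.baselineProfit B.truncate :=
    baselineProfit_le_of_le (fun s hs => B.rent_le_truncate_rent hs)
      fun s hs => B.margin_le_truncate_margin hs
  have hq : ∀ s ∈ Icc m.lo m.hi, B.truncate.quality s = B.quality s :=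
    fun s hs => hB.quality_eq hlam hle hs
  have hr : B.truncate.rent t = B.rent t := by
    rw [B.truncate.rent_eq ht, B.rent_eq ht, hB.rent_lo hlam, B.truncate_rent,
      intervalIntegral.integral_same]
    congr 1
    refine intervalIntegral.integral_congr fun x hx => hq x ?_
    rw [uIcc_of_le ht.1] at hx
    exact ⟨hx.1, hx.2.trans ht.2⟩
  have h := B.truncate_margin_nonneg ht
  rwa [Menu.margin_eq, hq t ht, hr, ← Menu.margin_eq] at h

/-- If all consumers shop on the platform, there is no rent without organic links. -/
theorem IsBaselineEquilibrium.rent_eq_zero {B : m.Menu} (hB : m.IsBaselineEquilibrium B)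
    (hlam : m.lam = 1) {v : ℝ} (hv : v ∈ Ico m.lo m.hi) : B.rent v = 0 := by
  have hvI : v ∈ Icc m.lo m.hi := ⟨hv.1, hv.2.le⟩
  by_contra hne
  have hpos : 0 < B.rent v := lt_of_le_of_ne (B.rent_nonneg hvI) (Ne.symm hne)
  -- Values in `(w, hi)` have mass `1 - F w > 0`, win with probability at least `F w ^ (J - 1) > 0`
  -- and receive at least `B.rent v`; the null menu saves this amount.
  obtain ⟨w, hw, hFw⟩ : ∃ w ∈ Ico v m.hi, 0 < m.F w := by
    have h1 : ∀ᶠ x in 𝓝[Icc m.lo m.hi] m.hi, 0 < m.F x :=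
      (m.F_continuousOn m.hi m.hi_mem).eventually (lt_mem_nhds (by rw [m.F_hi]; exact one_pos))
    have h2 : ∀ᶠ x in 𝓝[<] m.hi, x ∈ Ioo v m.hi := Ioo_mem_nhdsLT hv.2
    have h3 : 𝓝[Ioo v m.hi] m.hi ≤ 𝓝[Icc m.lo m.hi] m.hi :=
      nhdsWithin_mono _ fun x hx => ⟨hv.1.trans hx.1.le, hx.2.le⟩
    rw [nhdsWithin_Ioo_eq_nhdsLT hv.2] at h3
    obtain ⟨x, hx1, hx2⟩ := ((h1.filter_mono h3).and h2).exists
    exact ⟨x, ⟨hx2.1.le, hx2.2⟩, hx1⟩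
  have hwI : w ∈ Icc m.lo m.hi := ⟨hv.1.trans hw.1, hw.2.le⟩
  have hopt := hB (Menu.null m)
  rw [baselineProfit_eq, baselineProfit_eq] at hopt
  have hA := intervalIntegrable_baselineIntegrand (Menu.null m)
  have hB' := intervalIntegrable_baselineIntegrand B
  have hdiff : ∀ t, m.baselineIntegrand (Menu.null m) t - m.baselineIntegrand B t
      = B.rent t * (m.F t ^ (m.J - 1) * m.f t) := by
    intro t
    simp only [baselineIntegrand, hlam, Menu.null_rent]
    ring
  have hle : ∫ t in w..m.hi, B.rent v * m.F w ^ (m.J - 1) * m.f t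
      ≤ ∫ t in m.lo..m.hi, (m.baselineIntegrand (Menu.null m) t - m.baselineIntegrand B t) := by
    have hnn : ∀ t ∈ Ioo m.lo m.hi,
        0 ≤ m.baselineIntegrand (Menu.null m) t - m.baselineIntegrand B t := fun t ht => by
      have ht' := Ioo_subset_Icc_self ht
      rw [hdiff]
      exact mul_nonneg (B.rent_nonneg ht')
        (mul_nonneg (pow_nonneg (F_nonneg ht') _) (m.f_nonneg t ht))
    rw [← intervalIntegral.integral_add_adjacent_intervals
      ((hA.sub hB').mono_Icc m.lo_mem hwI) ((hA.sub hB').mono_Icc hwI m.hi_mem)]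
    have h1 := integral_nonneg_of_nonneg_Ioo hnn m.lo_mem hwI hwI.1
    have h2 := intervalIntegral.integral_mono_on_of_le_Ioo hw.2.le
      ((m.f_integrable.mono_Icc hwI m.hi_mem).const_mul (B.rent v * m.F w ^ (m.J - 1)))
      ((hA.sub hB').mono_Icc hwI m.hi_mem) fun t ht => by
        have ht' : t ∈ Icc m.lo m.hi := ⟨hwI.1.trans ht.1.le, ht.2.le⟩
        have hf := m.f_nonneg t ⟨hwI.1.trans_lt ht.1, ht.2⟩
        have hr := B.rent_monotoneOn hvI ht' (hw.1.trans ht.1.le)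
        have hF := m.F_monotoneOn hwI ht' ht.1.le
        have := B.rent_nonneg ht'
        show _ ≤ m.baselineIntegrand (Menu.null m) t - m.baselineIntegrand B t
        rw [hdiff, mul_assoc]
        gcongr
    linarith
  rw [intervalIntegral.integral_sub hA hB', intervalIntegral.integral_const_mul,
    ← primitive_sub_eq m.f_integrable hwI m.hi_mem] at hle
  have h1 := F_lt_one hwI hw.2
  have h2 : 0 < B.rent v * m.F w ^ (m.J - 1) * (m.F m.hi - m.F w) :=
    mul_pos (mul_pos hpos (pow_pos hFw _)) (by rw [m.F_hi]; linarith)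
  simp only [F] at h2
  simp only [F] at hle
  linarith

/-- A rent that vanishes on `[lo, hi)` has zero slope, hence zero quality there, and one-sided
continuity covers the endpoints. Incentive compatibility at `lo` then gives zero rent at `hi` too.
-/
theorem IsBaselineEquilibrium.quality_rent_le_of_lam_eq_one {B : m.Menu}
    (hB : m.IsBaselineEquilibrium B) (hlam : m.lam = 1) (M : m.Menu) {t : ℝ}
    (ht : t ∈ Icc m.lo m.hi) : B.quality t ≤ M.quality t ∧ B.rent t ≤ M.rent t := by
  have hq : ∀ s ∈ Icc m.lo m.hi, B.quality s ≤ (Menu.null m).quality s := by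
    refine fun s hs => B.quality_le_of_ae _ (Eventually.of_forall fun x hx => ?_) hs
    have hy : (x + m.hi) / 2 ∈ Ico m.lo m.hi := ⟨by linarith [hx.1, hx.2], by linarith [hx.2]⟩
    have h := B.rent_add_le (Ioo_subset_Icc_self hx) (Ico_subset_Icc_self hy)
    rw [hB.rent_eq_zero hlam ⟨hx.1.le, hx.2⟩, hB.rent_eq_zero hlam hy] at h
    show B.quality x ≤ 0
    by_contra! hpos
    have := mul_pos (show 0 < (x + m.hi) / 2 - x by linarith [hx.2]) hpos
    linarith
  have hq0 : B.quality t ≤ 0 := hq t ht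
  refine ⟨hq0.trans (M.quality_nonneg t ht), le_trans ?_ (M.rent_nonneg ht)⟩
  have h := B.rent_add_le ht m.lo_mem
  rw [hB.rent_eq_zero hlam ⟨le_rfl, m.lo_lt_hi⟩, le_antisymm hq0 (B.quality_nonneg t ht)] at h
  linarith

/-! ### Organic links -/

/-- Off-platform sales to on-platform consumers generated by organic links. -/
noncomputable def organicGain (m : Market) (N V : m.Menu) : ℝ :=
  ∫ t in m.lo..m.hi, N.margin t
    * max 0 (m.probBelow V (N.rent t) ^ (m.J - 1) - m.F t ^ (m.J - 1)) * m.f t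

theorem tame_gain (N V : m.Menu) :
    m.Tame fun t => max 0 (m.probBelow V (N.rent t) ^ (m.J - 1) - m.F t ^ (m.J - 1)) :=
  (Tame.const m 0).max (((tame_probBelow V N).pow _).sub (m.tame_F.pow _))

/-- A seller that matches the rivals' rent at every value keeps all its advertised sales: the
minimum is attained by `F`. -/
theorem organicProfit_of_rent_le {N V : m.Menu}
    (h : ∀ t ∈ Icc m.lo m.hi, V.rent t ≤ N.rent t) :
    m.organicProfit N V = m.baselineProfit N + m.lam * m.organicGain N V := by
  have e : ∫ t in m.lo..m.hi, (t ^ 2 / 2 - N.rent t)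
        * min (m.probAtMost V (N.rent t) ^ (m.J - 1)) (m.F t ^ (m.J - 1)) * m.f t
      = ∫ t in m.lo..m.hi, (t ^ 2 / 2 - N.rent t) * m.F t ^ (m.J - 1) * m.f t := by
    refine intervalIntegral.integral_congr fun t ht => ?_
    rw [uIcc_of_le m.lo_lt_hi.le] at ht
    have := pow_le_pow_left₀ (F_nonneg ht) (F_le_probAtMost V ht (h t ht)) (m.J - 1)
    simp only [min_eq_right this]
  rw [organicProfit, e]
  rfl

theorem organicProfit_self (V : m.Menu) : m.organicProfit V V = m.baselineProfit V := by
  rw [organicProfit_of_rent_le fun _ _ => le_rfl, organicGain]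
  have e : ∫ t in m.lo..m.hi, V.margin t
      * max 0 (m.probBelow V (V.rent t) ^ (m.J - 1) - m.F t ^ (m.J - 1)) * m.f t
      = ∫ _ in m.lo..m.hi, (0 : ℝ) := by
    refine intervalIntegral.integral_congr fun t ht => ?_
    rw [uIcc_of_le m.lo_lt_hi.le] at ht
    have := pow_le_pow_left₀ (probBelow_nonneg V _) (probBelow_rent_le_F V ht) (m.J - 1)
    simp only [max_eq_left (sub_nonpos.2 this), mul_zero, zero_mul]
  rw [e, intervalIntegral.integral_zero, mul_zero, add_zero]

/-- If the price covers the cost, a value that buys nothing has no rent. -/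
theorem Menu.rent_eq_zero_of_quality_eq_zero (A : m.Menu) {t : ℝ} (ht : t ∈ Icc m.lo m.hi)
    (hm : 0 ≤ A.margin t) (hq : A.quality t = 0) : A.rent t = 0 := by
  rw [Menu.margin_eq, hq] at hm
  linarith [A.rent_nonneg ht]

/-- No menu with higher rents, and with a nonnegative margin at the values that the equilibrium menu
leaves out, has a higher gross profit without organic links: a small move toward it has, to first
order, a nonnegative effect on the sales through organic links. -/
theorem IsOrganicEquilibrium.baselineProfit_le {M N : m.Menu} (hM : m.IsOrganicEquilibrium M)
    (hmargin : ∀ t ∈ Icc m.lo m.hi, 0 ≤ M.margin t)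
    (hrent : ∀ t ∈ Icc m.lo m.hi, M.rent t ≤ N.rent t)
    (hzero : ∀ t ∈ Icc m.lo m.hi, M.quality t = 0 → 0 ≤ N.margin t) :
    m.baselineProfit N ≤ m.baselineProfit M := by
  obtain ⟨C, hC⟩ := N.tame_margin.2
  set e : ℕ → ℝ := fun n => 1 / ((n : ℝ) + 1) with he
  have he0 : ∀ n, 0 < e n := fun n => Nat.one_div_pos_of_nat
  have he1 : ∀ n, e n ≤ 1 := fun n => by
    rw [he, div_le_one (Nat.cast_add_one_pos n)]
    linarith [Nat.cast_nonneg (α := ℝ) n]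
  have hlim : Tendsto e atTop (𝓝 0) := tendsto_one_div_add_atTop_nhds_zero_nat
  set W : ℕ → m.Menu := fun n => Menu.mix (e n) (he0 n).le (he1 n) M N with hW
  set k : ℕ → ℝ → ℝ := fun n t =>
    max 0 (m.probBelow M ((W n).rent t) ^ (m.J - 1) - m.F t ^ (m.J - 1)) with hk
  have hk0 : ∀ n t, 0 ≤ k n t := fun n t => le_max_left _ _
  have hk1 : ∀ n, ∀ t ∈ Icc m.lo m.hi, k n t ≤ 1 := fun n t ht => by
    have h1 := pow_le_one₀ (probBelow_nonneg M _) (probBelow_le_one M ((W n).rent t))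
      (n := m.J - 1)
    have h2 := pow_nonneg (F_nonneg ht) (m.J - 1)
    exact max_le zero_le_one (by linarith)
  -- Worst case, per unit of `e n`, of the sales through organic links: `k n` is the extra winning
  -- probability, and only the negative part of the margin of `N` can hurt.
  set l : ℕ → ℝ → ℝ := fun n t => min (N.margin t) 0 * k n t * m.f t with hl
  have hmin : m.Tame fun t => min (N.margin t) 0 := by
    have := (Tame.const m 0).sub
      (((Tame.const m 0).sub N.tame_margin).max (Tame.const m 0))
    convert this using 2 with t
    rcases le_total (N.margin t) 0 with h | h
    · rw [min_eq_left h, max_eq_left (by linarith)]; ring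
    · rw [min_eq_right h, max_eq_right (by linarith)]; ring
  have hli : ∀ n, IntervalIntegrable (l n) volume m.lo m.hi := fun n =>
    (hmin.mul (tame_gain (W n) M)).mul_f
  have hlt : Tendsto (fun n => ∫ t in m.lo..m.hi, l n t) atTop
      (𝓝 (∫ _ in m.lo..m.hi, (0 : ℝ))) := by
    refine intervalIntegral.tendsto_integral_filter_of_dominated_convergence
      (fun t => |C| * |m.f t|) (Eventually.of_forall fun n => ?_)
      (Eventually.of_forall fun n => Eventually.of_forall fun t ht => ?_)
      (m.f_integrable.abs.const_mul _) (Eventually.of_forall fun t ht => ?_)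
    · exact (hli n).def'.aestronglyMeasurable
    · rw [uIoc_of_le m.lo_lt_hi.le] at ht
      have ht' := Ioc_subset_Icc_self ht
      rw [hl, Real.norm_eq_abs, abs_mul, abs_mul, abs_of_nonneg (hk0 n t)]
      have h1 : |min (N.margin t) 0| ≤ |C| := by
        refine (abs_min_le_max_abs_abs).trans (max_le ((hC t ht').trans (le_abs_self _)) ?_)
        rw [abs_zero]
        exact abs_nonneg _
      have h2 := mul_le_mul h1 (hk1 n t ht') (hk0 n t) (abs_nonneg _)
      rw [mul_one] at h2
      exact mul_le_mul_of_nonneg_right h2 (abs_nonneg _)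
    · rw [uIoc_of_le m.lo_lt_hi.le] at ht
      have ht' := Ioc_subset_Icc_self ht
      -- At values with zero quality `k n t` need not vanish in the limit, but `hzero` removes the
      -- loss; elsewhere `tendsto_probBelow` makes `k n t` vanish.
      rcases (M.quality_nonneg t ht').eq_or_lt with hq | hq
      · have h0 : ∀ n, l n t = 0 := fun n => by
          rw [hl]
          simp only [min_eq_right (hzero t ht' hq.symm), zero_mul]
        simp only [h0]
        exact tendsto_const_nhds
      · have hd : 0 ≤ N.rent t - M.rent t := sub_nonneg.2 (hrent t ht')
        obtain ⟨P, hP, hPle⟩ := tendsto_probBelow M ht' hq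
          (e := fun n => e n * (N.rent t - M.rent t)) (fun n => mul_nonneg (he0 n).le hd)
          (by simpa using hlim.mul_const (N.rent t - M.rent t))
        have hkt : Tendsto (fun n => k n t) atTop (𝓝 0) := by
          have hup : Tendsto (fun n => max 0 (P n ^ (m.J - 1) - m.F t ^ (m.J - 1))) atTop
              (𝓝 0) := by
            have := (tendsto_const_nhds (x := (0 : ℝ))).max
              ((hP.pow (m.J - 1)).sub_const (m.F t ^ (m.J - 1)))
            rwa [sub_self, max_self] at this
          refine squeeze_zero (fun n => hk0 n t) (fun n => ?_) hup
          have hr : (W n).rent t = M.rent t + e n * (N.rent t - M.rent t) := by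
            rw [hW, Menu.mix_rent]
            ring
          have := hPle n
          rw [← hr] at this
          exact max_le_max le_rfl
            (sub_le_sub_right (pow_le_pow_left₀ (probBelow_nonneg M _) this _) _)
        have := (hkt.const_mul (min (N.margin t) 0)).mul_const (m.f t)
        simpa [hl] using this
  rw [intervalIntegral.integral_zero] at hlt
  -- Optimality of `M` against the deviation `W n`, divided by `e n`. The quadratic terms of the
  -- mixture and the margin of `M` are nonnegative and are dropped.
  have hstep : ∀ n, m.baselineProfit N + m.lam * ∫ t in m.lo..m.hi, l n t
      ≤ m.baselineProfit M := by
    intro n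
    have hWr : ∀ t ∈ Icc m.lo m.hi, M.rent t ≤ (W n).rent t := fun t ht => by
      rw [hW, Menu.mix_rent]
      have := mul_nonneg (he0 n).le (sub_nonneg.2 (hrent t ht))
      linarith
    have h1 := hM (W n)
    rw [organicProfit_self, organicProfit_of_rent_le hWr] at h1
    have hgain : e n * ∫ t in m.lo..m.hi, l n t ≤ m.organicGain (W n) M := by
      rw [organicGain, ← intervalIntegral.integral_const_mul]
      refine intervalIntegral.integral_mono_on_of_le_Ioo m.lo_lt_hi.le ((hli n).const_mul _)
        (((W n).tame_margin.mul (tame_gain (W n) M)).mul_f) fun t ht => ?_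
      have ht' := Ioo_subset_Icc_self ht
      have h2 : e n * min (N.margin t) 0 ≤ (W n).margin t := by
        rw [hW, Menu.mix_margin]
        have a1 := mul_nonneg (sub_nonneg.2 (he1 n)) (hmargin t ht')
        have a2 := mul_le_mul_of_nonneg_left (min_le_left (N.margin t) 0) (he0 n).le
        have a3 : 0 ≤ e n * (1 - e n) / 2 * (M.quality t - N.quality t) ^ 2 :=
          mul_nonneg (div_nonneg (mul_nonneg (he0 n).le (sub_nonneg.2 (he1 n))) two_pos.le)
            (sq_nonneg _)
        linarith
      have h3 := mul_le_mul_of_nonneg_right (mul_le_mul_of_nonneg_right h2 (hk0 n t))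
        (m.f_nonneg t ht)
      rw [hl]
      calc _ = e n * min (N.margin t) 0 * k n t * m.f t := by ring
        _ ≤ _ := h3
    have hmix := baselineProfit_mix (he0 n).le (he1 n) M N
    have hsq := integral_nonneg_of_nonneg_Ioo (a := m.lo) (b := m.hi)
      (h := fun t => (M.quality t - N.quality t) ^ 2 * m.G t ^ (m.J - 1) * m.g t)
      (fun t ht => mul_nonneg (mul_nonneg (sq_nonneg _)
        (pow_nonneg (G_nonneg (Ioo_subset_Icc_self ht)) _)) (m.g_nonneg t ht))
      m.lo_mem m.hi_mem m.lo_lt_hi.le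
    have hcoef : 0 ≤ e n * (1 - e n) / 2 * (1 - m.lam) :=
      mul_nonneg (div_nonneg (mul_nonneg (he0 n).le (sub_nonneg.2 (he1 n))) two_pos.le)
        (sub_nonneg.2 m.lam_le_one)
    have h4 := mul_nonneg hcoef hsq
    have h5 := mul_le_mul_of_nonneg_left hgain m.lam_nonneg
    have h6 : e n * (m.baselineProfit N + m.lam * ∫ t in m.lo..m.hi, l n t)
        ≤ e n * m.baselineProfit M := by
      change m.baselineProfit (W n) = _ at hmix
      linarith
    exact le_of_mul_le_mul_left h6 (he0 n)
  have := le_of_tendsto' ((hlt.const_mul m.lam).const_add (m.baselineProfit N)) hstep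
  simpa using this

/-- At each value max and min only permute the two qualities, so total costs agree pointwise. Rents
add up as well, being integrals of qualities plus bottom rents, one taken from each menu; and π is
linear in rents. -/
theorem baselineProfit_sup_add_inf (A B : m.Menu) :
    m.baselineProfit (A.sup B (A.rent m.lo) (A.rent_nonneg m.lo_mem))
      + m.baselineProfit (A.inf B (B.rent m.lo) (B.rent_nonneg m.lo_mem))
      = m.baselineProfit A + m.baselineProfit B := by
  set S := A.sup B (A.rent m.lo) (A.rent_nonneg m.lo_mem) with hS
  set I := A.inf B (B.rent m.lo) (B.rent_nonneg m.lo_mem) with hI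
  simp only [baselineProfit_eq]
  rw [← intervalIntegral.integral_add (intervalIntegrable_baselineIntegrand S)
    (intervalIntegrable_baselineIntegrand I), ← intervalIntegral.integral_add
    (intervalIntegrable_baselineIntegrand A) (intervalIntegrable_baselineIntegrand B)]
  refine intervalIntegral.integral_congr fun t ht => ?_
  rw [uIcc_of_le m.lo_lt_hi.le] at ht
  have hSq : ∀ x, S.quality x = max (A.quality x) (B.quality x) := fun _ => rfl
  have hIq : ∀ x, I.quality x = min (A.quality x) (B.quality x) := fun _ => rfl
  have hr : S.rent t + I.rent t = A.rent t + B.rent t := by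
    rw [S.rent_eq ht, I.rent_eq ht, A.rent_eq ht, B.rent_eq ht]
    have e1 : S.rent m.lo = A.rent m.lo := by rw [hS, Menu.sup_rent]; simp
    have e2 : I.rent m.lo = B.rent m.lo := by rw [hI, Menu.inf_rent]; simp
    have e3 := intervalIntegral.integral_add (S.intervalIntegrable_quality m.lo_mem ht)
      (I.intervalIntegrable_quality m.lo_mem ht)
    have e4 := intervalIntegral.integral_add (A.intervalIntegrable_quality m.lo_mem ht)
      (B.intervalIntegrable_quality m.lo_mem ht)
    simp only [hSq, hIq, max_add_min] at e3
    simp only [hSq, hIq]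
    rw [e1, e2]
    linarith
  have hmg : S.margin t + I.margin t = A.margin t + B.margin t := by
    simp only [Menu.margin_eq, hSq, hIq]
    rcases le_total (A.quality t) (B.quality t) with h | h
    · rw [max_eq_right h, min_eq_left h]; linarith
    · rw [max_eq_left h, min_eq_right h]; linarith
  simp only [baselineIntegrand]
  linear_combination (1 - m.lam) * m.G t ^ (m.J - 1) * m.g t * hmg
    - m.lam * m.F t ^ (m.J - 1) * m.f t * hr

/-- Organic links raise qualities and rents. -/
theorem IsOrganicEquilibrium.quality_rent_le {B M : m.Menu} (hM : m.IsOrganicEquilibrium M)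
    (hB : m.IsBaselineEquilibrium B) (hmargin : ∀ t ∈ Icc m.lo m.hi, 0 ≤ M.margin t) {t : ℝ}
    (ht : t ∈ Icc m.lo m.hi) : B.quality t ≤ M.quality t ∧ B.rent t ≤ M.rent t := by
  rcases m.lam_le_one.eq_or_lt with hlam | hlam
  · exact hB.quality_rent_le_of_lam_eq_one hlam M ht
  set S := M.sup B (M.rent m.lo) (M.rent_nonneg m.lo_mem) with hS
  have hSM : m.baselineProfit S ≤ m.baselineProfit M := by
    refine hM.baselineProfit_le hmargin (fun s hs => ?_) fun s hs hq => ?_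
    · have e : S.rent m.lo = M.rent m.lo := by rw [hS, Menu.sup_rent]; simp
      rw [S.rent_eq hs, M.rent_eq hs, e]
      have := intervalIntegral.integral_mono_on hs.1 (M.intervalIntegrable_quality m.lo_mem hs)
        (S.intervalIntegrable_quality m.lo_mem hs) fun x _ => le_max_left _ _
      linarith
    -- Up to a value that `M` leaves out, `M` gives neither quality nor rent, so `S` coincides with
    -- `B` there and inherits its nonnegative margin.
    · have hMs := M.rent_eq_zero_of_quality_eq_zero hs (hmargin s hs) hq
      have hlo : M.rent m.lo = 0 := le_antisymm
        (hMs ▸ M.rent_monotoneOn m.lo_mem hs hs.1) (M.rent_nonneg m.lo_mem)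
      have hqx : ∀ x ∈ Icc m.lo s, max (M.quality x) (B.quality x) = B.quality x :=
        fun x hx => by
          have hx' : x ∈ Icc m.lo m.hi := ⟨hx.1, hx.2.trans hs.2⟩
          exact max_eq_right ((M.quality_monotoneOn hx' hs hx.2).trans
            (hq ▸ B.quality_nonneg x hx'))
      have hSr : S.rent s = B.rent s := by
        rw [hS, Menu.sup_rent, B.rent_eq hs, hlo, hB.rent_lo hlam]
        congr 1
        refine intervalIntegral.integral_congr fun x hx => hqx x ?_
        rwa [uIcc_of_le hs.1] at hx
      have hSq : S.quality s = B.quality s := hqx s ⟨hs.1, le_rfl⟩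
      have := hB.margin_nonneg hlam hs
      rwa [Menu.margin_eq, hSr, hSq, ← Menu.margin_eq]
  -- With `hSM`, modularity makes the lower envelope at least as profitable as `B`, so uniqueness
  -- applies to it.
  have hmod := baselineProfit_sup_add_inf M B
  have hq : ∀ s ∈ Icc m.lo m.hi, B.quality s ≤ M.quality s := fun s hs => by
    have h : min (M.quality s) (B.quality s) = B.quality s :=
      hB.quality_eq hlam (A := M.inf B (B.rent m.lo) (B.rent_nonneg m.lo_mem))
        (by linarith) hs
    exact min_eq_right_iff.1 h
  refine ⟨hq t ht, ?_⟩
  rw [B.rent_eq ht, M.rent_eq ht, hB.rent_lo hlam]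
  have h1 := intervalIntegral.integral_mono_on ht.1 (B.intervalIntegrable_quality m.lo_mem ht)
    (M.intervalIntegrable_quality m.lo_mem ht)
    fun x hx => hq x ⟨hx.1, hx.2.trans ht.2⟩
  have h2 := M.rent_nonneg m.lo_mem
  linarith

/-! ### Outside options -/

theorem intervalIntegrable_deviation (N V : m.Menu) :
    IntervalIntegrable (fun t => N.margin t
      * ((1 - m.lam) * m.G t ^ (m.J - 1) * m.g t
        + m.lam * m.probBelow V (N.rent t) ^ (m.J - 1) * m.f t)) volume m.lo m.hi := by
  have h1 := (intervalIntegrable_off N).const_mul (1 - m.lam)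
  have h2 := ((N.tame_margin.mul ((tame_probBelow V N).pow (m.J - 1))).mul_f).const_mul m.lam
  refine (h1.add h2).congr fun t _ => ?_
  ring

theorem bddAbove_organicDeviationProfit (V : m.Menu) :
    BddAbove (range fun N : m.Menu => m.organicDeviationProfit N V) := by
  refine ⟨∫ t in m.lo..m.hi, m.hi ^ 2 / 2 * ((1 - m.lam) * m.g t + m.lam * m.f t), ?_⟩
  rintro _ ⟨N, rfl⟩
  refine intervalIntegral.integral_mono_on_of_le_Ioo m.lo_lt_hi.le
    (intervalIntegrable_deviation N V)
    (((m.g_integrable.const_mul _).add (m.f_integrable.const_mul _)).const_mul _) fun t ht => ?_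
  have ht' := Ioo_subset_Icc_self ht
  have hl := m.lam_nonneg
  have hl' := sub_nonneg.2 m.lam_le_one
  have hf := m.f_nonneg t ht
  have hg := m.g_nonneg t ht
  have hG := pow_nonneg (G_nonneg ht') (m.J - 1)
  have hP := pow_nonneg (probBelow_nonneg V (N.rent t)) (m.J - 1)
  have hG1 := pow_le_one₀ (G_nonneg ht') (G_le_one ht') (n := m.J - 1)
  have hP1 := pow_le_one₀ (probBelow_nonneg V (N.rent t)) (probBelow_le_one V (N.rent t))
    (n := m.J - 1)
  have hhi : 0 ≤ m.hi ^ 2 / 2 := by positivity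
  have h1 : (1 - m.lam) * m.G t ^ (m.J - 1) * m.g t ≤ (1 - m.lam) * m.g t :=
    mul_le_mul_of_nonneg_right (mul_le_of_le_one_right hl' hG1) hg
  have h2 : m.lam * m.probBelow V (N.rent t) ^ (m.J - 1) * m.f t ≤ m.lam * m.f t :=
    mul_le_mul_of_nonneg_right (mul_le_of_le_one_right hl hP1) hf
  exact (mul_le_mul_of_nonneg_right (N.margin_le ht') (by positivity)).trans
    (mul_le_mul_of_nonneg_left (add_le_add h1 h2) hhi)

/-- Truncation raises the off-platform margins, and sales through organic links at nonnegative
margins only add profit, whatever the rivals post. -/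
theorem offProfit_le_organicDeviationProfit_truncate (N V : m.Menu) :
    m.offProfit N ≤ m.organicDeviationProfit N.truncate V := by
  rw [offProfit, ← intervalIntegral.integral_const_mul]
  refine intervalIntegral.integral_mono_on_of_le_Ioo m.lo_lt_hi.le
    ((intervalIntegrable_off N).const_mul _) (intervalIntegrable_deviation _ V) fun t ht => ?_
  have ht' := Ioo_subset_Icc_self ht
  have hl' := sub_nonneg.2 m.lam_le_one
  have hw : 0 ≤ (1 - m.lam) * m.G t ^ (m.J - 1) * m.g t :=
    mul_nonneg (mul_nonneg hl' (pow_nonneg (G_nonneg ht') _)) (m.g_nonneg t ht)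
  have hp : 0 ≤ m.lam * m.probBelow V (N.truncate.rent t) ^ (m.J - 1) * m.f t :=
    mul_nonneg (mul_nonneg m.lam_nonneg (pow_nonneg (probBelow_nonneg V _) _)) (m.f_nonneg t ht)
  have h1 := mul_le_mul_of_nonneg_right (N.margin_le_truncate_margin ht') hw
  have h2 := mul_nonneg (N.truncate_margin_nonneg ht') hp
  linarith

theorem bddAbove_offProfit (m : Market) : BddAbove (range fun N : m.Menu => m.offProfit N) := by
  obtain ⟨C, hC⟩ := bddAbove_organicDeviationProfit (Menu.null m)
  refine ⟨C, ?_⟩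
  rintro _ ⟨N, rfl⟩
  exact (offProfit_le_organicDeviationProfit_truncate N _).trans (hC ⟨_, rfl⟩)

theorem baselineOutside_le_organicOutside (V : m.Menu) :
    m.baselineOutside ≤ m.organicOutside V := by
  refine csSup_le ⟨_, Menu.null m, rfl⟩ ?_
  rintro _ ⟨N, rfl⟩
  exact (offProfit_le_organicDeviationProfit_truncate N V).trans
    (le_csSup (bddAbove_organicDeviationProfit V) ⟨_, rfl⟩)

end Market

theorem proposition5 (m : Market) (B M : m.Menu)
    (hB : m.IsBaselineEquilibrium B) (hM : m.IsOrganicEquilibrium M)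
    (hcost : ∀ t ∈ Set.Icc m.lo m.hi, Market.cost (M.quality t) ≤ M.price t) :
    (∀ t ∈ Set.Icc m.lo m.hi, B.quality t ≤ M.quality t ∧ B.rent t ≤ M.rent t) ∧
    m.organicProfit M M ≤ m.baselineProfit B ∧
    BddAbove (Set.range fun N : m.Menu => m.offProfit N) ∧
    BddAbove (Set.range fun N : m.Menu => m.organicDeviationProfit N M) ∧
    m.baselineOutside ≤ m.organicOutside M ∧
    m.organicBudget M ≤ m.baselineBudget B := by
  have hprofit : m.organicProfit M M ≤ m.baselineProfit B := by
    rw [Market.organicProfit_self]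
    exact hB M
  have houtside := Market.baselineOutside_le_organicOutside M
  refine ⟨fun t ht => hM.quality_rent_le hB (fun s hs => ?_) ht, hprofit,
    Market.bddAbove_offProfit m, Market.bddAbove_organicDeviationProfit M, houtside,
    sub_le_sub hprofit houtside⟩
  rw [Market.Menu.margin_eq_price_sub_cost]
  exact sub_nonneg.2 (hcost s hs)
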